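/- Let $M$ be a finite matroid of rank $n$ on a ground set $\mathcal P$, and realize it by vectors over $\mathbb C$. **Subspaces.** Call two circuits of $M$ of size less than $n+1$ equivalent if they have the same closure. The equivalence classes are called the subspaces of $M$, and $\mathcal L$ denotes the set of subspaces. The rank $\operatorname{rank}(l)$ of a subspace $l$ is the rank of any circuit in $l$. A point $p$ lies in $l$ if $p\in C$ for some circuit $C\in l$, and $\mathcal L_p$ is the set of subspaces that contain $p$. For $L\subseteq\mathcal L$ put $$a_L=\sum_{l\in L}\operatorname{rank}(l)-n(|L|-1),\qquad a_p=a_{\mathcal L_p},\qquad P_M=\{p\in\mathcal P: a_p\le 0\}.$$ **Solvable and special matroids.** Let $M^0=M$ and $M^{j+1}=P_{M^j}$, each considered as a submatroid (restriction) of $M$, with its own rank and its own subspaces. The matroid $M$ is *solvable* if $M^j=\emptyset$ for some $j$. A solvable matroid is *special* if for all $j\ge 0$, all $q\in M^j\setminus M^{j+1}$ and all $L\subseteq\mathcal L_q$ (subspaces of $M^j$) one has $$\operatorname{rank}\Big(\bigcap_{l\in L}l\Big)\le a_L,$$ where $\bigcap_{l\in L} l$ is the set of points of $M^j$ common to all $l\in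 L$, and $a_L$ is computed in $M^j$. **Stable realizations.** Let $\Gamma_M$ be the set of collections of vectors $\gamma=(\gamma_p)_{p\in\mathcal P}$ in $\mathbb C^n$ whose linear dependencies are exactly those of $M$; $M$ is *realizable* if $\Gamma_M\ne\emptyset$. For a subspace $l$ let $\gamma_l$ be the span of $\{\gamma_p: p\in l\}$. Let $\Gamma_M^0$ be the set of *stable realizations*: those $\gamma\in\Gamma_M$ such that, for every $j\ge 0$ and every point $p$ of $M^j$ not in $P_{M^j}$, $$\dim\bigcap_{l\in\mathcal L_p}(\gamma|_{M^j})_l=a_p ,$$ where $\mathcal L_p$ and $a_p$ are computed in $M^j$ and an empty intersection is read as the span of $\gamma|_{M^j}$. **Theorem.** Suppose that $P_M=\emptyset$. If $M$ is a special solvable matroid, then $\Gamma_M^0\neq\emptyset$, and $M$ is realizable. Moreover, $\Gamma_M^0\ne\emptyset$ if and only if $M$ is special. -/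

import Mathlib

namespace StableMatroid

noncomputable section

/-! ### Subspaces of a matroid -/

/-- The rank of a set of points, as a natural number (all matroids of interest here are finite). -/
def rk {α : Type*} (M : Matroid α) (X : Set α) : ℕ := (M.eRk X).toNat

/-- The rank of the matroid, as a natural number. -/
def rank {α : Type*} (M : Matroid α) : ℕ := (M.eRank).toNat

/-- A circuit of size less than `n + 1`, where `n` is the rank of `M`. -/
def IsSmallCircuit {α : Type*} (M : Matroid α) (C : Set α) : Prop :=
  M.IsCircuit C ∧ C.encard < M.eRank + 1

/-- The class of `C` for the relation `C₁ ∼ C₂ ↔ closure C₁ = closure C₂` on small circuits. -/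
def circuitClass {α : Type*} (M : Matroid α) (C : Set α) : Set (Set α) :=
  {C' | IsSmallCircuit M C' ∧ M.closure C' = M.closure C}

/-- The set `𝓛` of subspaces of `M`: the equivalence classes of small circuits. -/
def subspaces {α : Type*} (M : Matroid α) : Set (Set (Set α)) :=
  {l | ∃ C, IsSmallCircuit M C ∧ l = circuitClass M C}

/-- The points of a subspace `l`: those lying on some circuit that belongs to the class `l`. -/
def pointsOf {α : Type*} (l : Set (Set α)) : Set α := {p | ∃ C ∈ l, p ∈ C}

/-- The rank of a subspace `l`. By `subspaceRank_eq` below this is the rank of any circuit in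
`l`. -/
def subspaceRank {α : Type*} (M : Matroid α) (l : Set (Set α)) : ℕ := rk M (pointsOf l)

theorem subspaceRank_eq {α : Type*} (M : Matroid α) {l : Set (Set α)} (hl : l ∈ subspaces M)
    {C : Set α} (hC : C ∈ l) : subspaceRank M l = rk M C := by
  obtain ⟨C₀, -, rfl⟩ := hl
  have h1 : C ⊆ pointsOf (circuitClass M C₀) := fun p hp => ⟨C, hC, hp⟩
  have h2 : pointsOf (circuitClass M C₀) ⊆ M.closure C := by
    rintro p ⟨C', hC', hp⟩
    rw [hC.2, ← hC'.2]
    exact M.subset_closure C' hC'.1.1.subset_ground hp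
  have h3 : M.eRk (pointsOf (circuitClass M C₀)) = M.eRk C :=
    le_antisymm ((M.eRk_mono h2).trans (M.eRk_closure_eq C).le) (M.eRk_mono h1)
  simp [subspaceRank, rk, h3]

/-- The set `𝓛_p` of subspaces of `M` that contain the point `p`. -/
def subspacesThrough {α : Type*} (M : Matroid α) (p : α) : Set (Set (Set α)) :=
  {l | l ∈ subspaces M ∧ p ∈ pointsOf l}

/-- The expected dimension `a_L = ∑_{l ∈ L} rank l - n (|L| - 1)` of a (finite) set `L` of
subspaces, where `n` is the rank of `M`. -/
def expectedDim {α : Type*} (M : Matroid α) (L : Set (Set (Set α))) : ℤ :=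
  (∑ᶠ l ∈ L, (subspaceRank M l : ℤ)) - (rank M : ℤ) * ((L.ncard : ℤ) - 1)

/-- The set `P_M` of points `p` of `M` with `a_p ≤ 0`, where `a_p = a_{𝓛_p}`. -/
def nonposPoints {α : Type*} (M : Matroid α) : Set α :=
  {p | p ∈ M.E ∧ expectedDim M (subspacesThrough M p) ≤ 0}

/-! ### Solvable and special matroids -/

/-- The solvable chain `M⁰ = M`, `M^{j+1} = P_{M^j}`, each member being viewed as a submatroid. -/
def solvableChain {α : Type*} (M : Matroid α) : ℕ → Matroid α
  | 0 => M
  | j + 1 => (solvableChain M j).restrict (nonposPoints (solvableChain M j))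

theorem solvableChain_ground_subset {α : Type*} (M : Matroid α) (j : ℕ) :
    (solvableChain M j).E ⊆ M.E := by
  induction j with
  | zero => exact subset_rfl
  | succ j ih => exact fun p hp => ih hp.1

/-- `M` is solvable if its solvable chain reaches the empty set. -/
def IsSolvable {α : Type*} (M : Matroid α) : Prop := ∃ j, (solvableChain M j).E = ∅

/-- `M` is special if it is solvable and, for all `j`, all `q ∈ M^j \ M^{j+1}` and all
`L ⊆ 𝓛_q` (subspaces of `M^j`), the points of `M^j` common to all members of `L` have rank at
most `a_L` (computed in `M^j`). -/
def IsSpecial {α : Type*} (M : Matroid α) : Prop :=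
  IsSolvable M ∧
    ∀ j : ℕ, ∀ q ∈ (solvableChain M j).E \ (solvableChain M (j + 1)).E,
      ∀ L ⊆ subspacesThrough (solvableChain M j) q,
        (rk (solvableChain M j) {p | p ∈ (solvableChain M j).E ∧ ∀ l ∈ L, p ∈ pointsOf l} : ℤ) ≤
          expectedDim (solvableChain M j) L

/-! ### Realizations and stable realizations -/

/-- The realization space `Γ_{M,d}`: the collections of vectors of `ℂ^d`, indexed by the points
of `M`, whose linear dependencies are exactly those of `M`. -/
def realizationSpace {α : Type*} (M : Matroid α) (d : ℕ) : Set (M.E → (Fin d → ℂ)) :=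
  {γ | ∀ I : Set M.E, M.Indep (Subtype.val '' I) ↔ LinearIndepOn ℂ γ I}

/-- `M` is realizable if it has a realization in `ℂ^n`, where `n` is the rank of `M`. -/
def IsRealizable {α : Type*} (M : Matroid α) : Prop := (realizationSpace M (rank M)).Nonempty

/-- The circuit variety `V_{C(M),d}`: the collections of vectors of `ℂ^d` in which every circuit
of `M` is linearly dependent. -/
def circuitVariety {α : Type*} (M : Matroid α) (d : ℕ) : Set (M.E → (Fin d → ℂ)) :=
  {γ | ∀ C : Set M.E, M.IsCircuit (Subtype.val '' C) → ¬ LinearIndepOn ℂ γ C}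

/-- The span `γ_l` of the vectors of `γ` at the points of `l`. -/
def subspaceSpan {α : Type*} {E : Set α} {d : ℕ} (γ : E → (Fin d → ℂ)) (l : Set (Set α)) :
    Submodule ℂ (Fin d → ℂ) :=
  Submodule.span ℂ (γ '' {p | (p : α) ∈ pointsOf l})

/-- The intersection `V_{γ,p}` of the `γ_l` for `l ∈ 𝓛_p`, taken inside the span of `γ`. The span
matters only if `𝓛_p` is empty: the empty intersection is the space spanned by `γ`. -/
def meetAt {α : Type*} (M : Matroid α) {d : ℕ} (γ : M.E → (Fin d → ℂ)) (p : α) :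
    Submodule ℂ (Fin d → ℂ) :=
  Submodule.span ℂ (Set.range γ) ⊓ ⨅ l ∈ subspacesThrough M p, subspaceSpan γ l

/-- A member of the circuit variety is quasi-stable if `dim V_{γ,p} = a_p` for every point
`p ∉ P_M`. -/
def IsQuasiStable {α : Type*} (M : Matroid α) {d : ℕ} (γ : M.E → (Fin d → ℂ)) : Prop :=
  γ ∈ circuitVariety M d ∧
    ∀ p ∈ M.E, p ∉ nonposPoints M →
      (Module.finrank ℂ (meetAt M γ p) : ℤ) = expectedDim M (subspacesThrough M p)

/-- The restriction of a collection of vectors indexed by `M` to the submatroid `M^j`. -/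
def restrictChain {α : Type*} (M : Matroid α) {d : ℕ} (γ : M.E → (Fin d → ℂ)) (j : ℕ) :
    (solvableChain M j).E → (Fin d → ℂ) :=
  fun p => γ (Set.inclusion (solvableChain_ground_subset M j) p)

/-- The set `Γ_M⁰` of stable realizations: the realizations of `M` in `ℂ^n`, `n = rank M`, whose
restriction to every `M^j` is quasi-stable (this holds trivially once `M^j` is empty). -/
def stableRealizations {α : Type*} (M : Matroid α) : Set (M.E → (Fin (rank M) → ℂ)) :=
  {γ | γ ∈ realizationSpace M (rank M) ∧
    ∀ j : ℕ, IsQuasiStable (solvableChain M j) (restrictChain M γ j)}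

end

end StableMatroid

namespace StableMatroid

open Finset

/-! ### Generic choices -/

/-! Since `P_M = ∅`, the chain is `M, ∅`, so stability only asks that the `γ_l` with `l ∈ 𝓛_q` meet
in dimension `a_q` for each point `q`. Put `codim l = n - rank l`; then `a_L = n - ∑ codim l`.

Stable implies special: the points common to `L` span a subspace of `V = ⋂_{l ∈ L} γ_l`. Cutting `V`
by the remaining `γ_l` through `q` lowers its dimension by at most the sum of their codimensions and
ends inside a space of dimension `a_q`; hence `dim V ≤ a_L`.

Special implies stable: let `W l` be cut out by `codim l` generic linear forms. As `a_q > 0`, the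
forms through `q` number at most `n - 1`; auxiliary forms fill them up to `n - 1`, and the signed
maximal minors give a vector `γ_q` in every `W l` through `q`. It remains to see that each basis `b`
gets independent vectors, a polynomial condition that need only be met once
(`exists_det_genericPoint_ne_zero`). Kill the `m`-th coefficient of every form that must vanish at
`b m`: then `γ_{b i}` is a multiple of the `i`-th unit vector, and it can be made nonzero if the
forms through `b i` can be matched with coordinates where they survive. Hall's condition for this
matching is the special inequality (`IsArrangement.exists_perm`). Circuits are dependent because
`dim W l = rank l`. -/

/-- Finitely many polynomials, each nonzero at some point, are simultaneously nonzero at some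
point. -/
theorem exists_forall_eval_ne_zero {K σ ι : Type*} [Field K] [Infinite K] [Finite ι]
    (F : ι → MvPolynomial σ K) (h : ∀ i, ∃ x, MvPolynomial.eval x (F i) ≠ 0) :
    ∃ x, ∀ i, MvPolynomial.eval x (F i) ≠ 0 := by
  have := Fintype.ofFinite ι
  have hF : ∏ i, F i ≠ 0 := by
    refine prod_ne_zero_iff.2 fun i _ hi => ?_
    obtain ⟨x, hx⟩ := h i
    exact hx (by simp [hi])
  by_contra! hcon
  refine hF (MvPolynomial.funext fun x => ?_)
  obtain ⟨i, hi⟩ := hcon x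
  rw [map_prod, map_zero]
  exact prod_eq_zero (mem_univ i) hi

/-- The common zero space of linearly independent linear forms has the expected dimension. -/
theorem finrank_ker_mulVecLin_add_card {K ι : Type*} [Field K] [Fintype ι] {n : ℕ}
    {A : Matrix ι (Fin n) K} (hA : LinearIndependent K A) :
    Module.finrank K (LinearMap.ker A.mulVecLin) + Fintype.card ι = n := by
  have h := LinearMap.finrank_range_add_finrank_ker A.mulVecLin
  have hr : A.rank = Fintype.card ι := LinearIndependent.rank_matrix hA
  rw [Matrix.rank] at hr
  rw [hr, Module.finrank_fin_fun] at h
  omega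

/-- The column of the adjugate at `i₀` is killed by all rows other than `i₀`. -/
theorem row_dotProduct_adjugate_eq_zero {R m : Type*} [CommRing R] [Fintype m] [DecidableEq m]
    (A : Matrix m m R) {i₀ j : m} (hj : j ≠ i₀) : A j ⬝ᵥ (fun i => A.adjugate i i₀) = 0 := by
  have h := congrFun (congrFun (Matrix.mul_adjugate A) j) i₀
  simpa [Matrix.mul_apply, dotProduct, Matrix.one_apply_ne hj] using h

/-- If a column of the adjugate at `i₀` is nonzero, then the rows other than `i₀` are linearly
independent. -/
theorem linearIndependent_of_adjugate_ne_zero {K m κ : Type*} [Field K] [Fintype m]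
    [DecidableEq m] (A : Matrix m m K) {i i₀ : m} (hi : A.adjugate i i₀ ≠ 0) (f : κ → m)
    (hf : Function.Injective f) (hf₀ : ∀ k, f k ≠ i₀) : LinearIndependent K fun k => A (f k) := by
  -- The entry is the determinant of `A` with row `i₀` replaced by a unit vector.
  rw [Matrix.adjugate_apply] at hi
  have h := Matrix.linearIndependent_rows_of_det_ne_zero hi
  have h' := h.comp f hf
  have heq : (fun k => A (f k)) = (fun j => A.updateRow i₀ (Pi.single i 1) j) ∘ f := by
    ext k x
    simp [Matrix.updateRow_ne (hf₀ k)]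
  rw [heq]
  exact h'

/-- If the column `i` of an invertible matrix vanishes outside the row `i₀`, then the column `i₀`
of the adjugate is a nonzero multiple of the `i`-th unit vector. -/
theorem adjugate_of_col_eq_zero {K m : Type*} [Field K] [Fintype m] [DecidableEq m]
    (A : Matrix m m K) {i i₀ : m} (hA : A.det ≠ 0) (h : ∀ j, j ≠ i₀ → A j i = 0) :
    A.adjugate i i₀ ≠ 0 ∧ ∀ k, k ≠ i → A.adjugate k i₀ = 0 := by
  have key : ∀ k, A.adjugate k i₀ * A i₀ i = A.det * (1 : Matrix m m K) k i := by
    intro k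
    have h' := congrFun (congrFun (Matrix.adjugate_mul A) k) i
    rw [Matrix.mul_apply, sum_eq_single i₀ (fun j _ hj => by simp [h j hj]) (by simp)] at h'
    simpa using h'
  have hi : A.adjugate i i₀ * A i₀ i ≠ 0 := by rw [key]; simpa using hA
  refine ⟨left_ne_zero_of_mul hi, fun k hk => ?_⟩
  have := key k
  rw [Matrix.one_apply_ne hk, mul_zero] at this
  exact (mul_eq_zero.1 this).resolve_right (right_ne_zero_of_mul hi)

/-! ### Generic subspaces and generic points in their intersections -/

section Generic

variable {Λ E : Type*} {n : ℕ} {c : Λ → ℕ}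

/-- Index set for linear forms on an `n`-dimensional space: `c l` forms for each `l`, and `n`
auxiliary forms for each point. -/
abbrev FormIndex (E : Type*) (n : ℕ) (c : Λ → ℕ) : Type _ := (Σ l, Fin (c l)) ⊕ (E × Fin n)

/-- A list `ρ` of `n` forms consisting of all forms of the members of `S`, and of auxiliary forms
of the point `q`, the one at `i₀` being auxiliary. -/
structure IsArrangement (i₀ : Fin n) (S : Set Λ) (q : E) (ρ : Fin n → FormIndex E n c) :
    Prop where
  injective : Function.Injective ρ
  apply_self : ρ i₀ = Sum.inr (q, i₀)
  cases : ∀ j, ρ j = Sum.inr (q, j) ∨ ∃ x : Σ l, Fin (c l), x.1 ∈ S ∧ ρ j = Sum.inl x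
  exists_eq : ∀ x : Σ l, Fin (c l), x.1 ∈ S → ∃ j, ρ j = Sum.inl x

theorem exists_isArrangement (i₀ : Fin n) (S : Finset Λ) (q : E) (h : ∑ l ∈ S, c l < n) :
    ∃ ρ : Fin n → FormIndex E n c, IsArrangement i₀ (S : Set Λ) q ρ := by
  classical
  let T := S.sigma fun l => (univ : Finset (Fin (c l)))
  -- Row `i₀` stays free for an auxiliary form; this is where the strict inequality `h` is needed.
  have hT : Fintype.card T ≤ Fintype.card {j : Fin n // j ≠ i₀} := by
    have h1 : Fintype.card T = ∑ l ∈ S, c l := by simp [T]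
    have h2 : Fintype.card {j : Fin n // j ≠ i₀} = n - 1 := by simp
    omega
  obtain ⟨s⟩ := Function.Embedding.nonempty_of_card_le hT
  have hs : ∀ x y, (s x : Fin n) = s y → x = y := fun x y h => s.injective (Subtype.ext h)
  let ρ : Fin n → FormIndex E n c := fun j =>
    if hj : ∃ x, (s x : Fin n) = j then Sum.inl hj.choose.1 else Sum.inr (q, j)
  have hρ1 : ∀ x, ρ (s x) = Sum.inl x.1 := by
    intro x
    have hj : ∃ y, (s y : Fin n) = s x := ⟨x, rfl⟩
    simp only [ρ, dif_pos hj]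
    rw [hs _ _ hj.choose_spec]
  have hρ2 : ∀ j, (¬ ∃ x, (s x : Fin n) = j) → ρ j = Sum.inr (q, j) := by
    intro j hj
    simp only [ρ, dif_neg hj]
  refine ⟨ρ, ?_, ?_, ?_, ?_⟩
  · intro j k hjk
    by_cases hj : ∃ x, (s x : Fin n) = j <;> by_cases hk : ∃ x, (s x : Fin n) = k
    · obtain ⟨x, rfl⟩ := hj
      obtain ⟨y, rfl⟩ := hk
      rw [hρ1, hρ1] at hjk
      rw [Subtype.ext (Sum.inl_injective hjk)]
    · obtain ⟨x, rfl⟩ := hj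
      rw [hρ1, hρ2 k hk] at hjk
      cases hjk
    · obtain ⟨y, rfl⟩ := hk
      rw [hρ1, hρ2 j hj] at hjk
      cases hjk
    · rw [hρ2 j hj, hρ2 k hk] at hjk
      exact (Prod.ext_iff.1 (Sum.inr_injective hjk)).2
  · exact hρ2 _ fun ⟨x, hx⟩ => (s x).2 hx
  · intro j
    by_cases hj : ∃ x, (s x : Fin n) = j
    · obtain ⟨x, rfl⟩ := hj
      exact Or.inr ⟨x.1, (mem_sigma.1 x.2).1, hρ1 x⟩
    · exact Or.inl (hρ2 j hj)
  · intro x hx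
    exact ⟨_, hρ1 ⟨x, mem_sigma.2 ⟨hx, mem_univ _⟩⟩⟩

/-- By Hall's marriage theorem, the forms through `b i` can be matched with the coordinates so that
no form of `l` is matched with the coordinate of a point of `l`. -/
theorem IsArrangement.exists_perm {inc : E → Λ → Prop} {i₀ : Fin n} {b : Fin n → E} {i : Fin n}
    {ρ : Fin n → FormIndex E n c} (hρ : IsArrangement i₀ {l | inc (b i) l} (b i) ρ)
    (hall : ∀ L : Finset Λ, (∀ l ∈ L, inc (b i) l) →
      Set.ncard {m | ∀ l ∈ L, inc (b m) l} + ∑ l ∈ L, c l ≤ n) :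
    ∃ σ : Equiv.Perm (Fin n), σ i₀ = i ∧ ∀ j x, ρ j = Sum.inl x → ¬ inc (b (σ j)) x.1 := by
  classical
  let T := {x : Σ l, Fin (c l) // inc (b i) x.1}
  let t : T → Finset (Fin n) := fun x => univ.filter fun m => ¬ inc (b m) x.1.1
  have h1 : ∀ s : Finset T, #s ≤ #(s.biUnion t) := by
    intro s
    let L : Finset Λ := s.image fun x => x.1.1
    have hL : ∀ l ∈ L, inc (b i) l := by
      intro l hl
      obtain ⟨x, -, rfl⟩ := mem_image.1 hl
      exact x.2
    have h2 : #s ≤ ∑ l ∈ L, c l := by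
      calc #s = #(s.image Subtype.val) := (card_image_of_injective _ Subtype.val_injective).symm
        _ ≤ #(L.sigma fun l => (univ : Finset (Fin (c l)))) := by
            refine card_le_card fun x hx => ?_
            obtain ⟨y, hy, rfl⟩ := mem_image.1 hx
            exact mem_sigma.2 ⟨mem_image_of_mem _ hy, mem_univ _⟩
        _ = ∑ l ∈ L, c l := by simp
    -- A coordinate is unavailable to all of `s` exactly when its point lies on every member of `L`,
    -- so `hall` bounds the number of such coordinates.
    have h3 : s.biUnion t = (univ.filter fun m => ∀ l ∈ L, inc (b m) l)ᶜ := by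
      ext m
      simp [t, L]
    have h4 := hall L hL
    have h5 : Set.ncard {m | ∀ l ∈ L, inc (b m) l} = #(univ.filter fun m => ∀ l ∈ L, inc (b m) l) := by
      rw [← Set.ncard_coe_finset]
      simp
    rw [h3, card_compl, Fintype.card_fin]
    omega
  obtain ⟨f, hf, hft⟩ := (all_card_le_biUnion_card_iff_exists_injective t).1 h1
  have hft' : ∀ x, ¬ inc (b (f x)) x.1.1 := fun x => (mem_filter.1 (hft x)).2
  have hfi : ∀ x, f x ≠ i := fun x hx => hft' x (by rw [hx]; exact x.2)
  -- The default `i` is meant for row `i₀`. Other auxiliary rows also receive it, so `g` is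
  -- injective only on `D` and is then extended to a permutation.
  let g : Fin n → Fin n := fun j => if h : ∃ x : T, ρ j = Sum.inl x.1 then f h.choose else i
  have hg : ∀ j (x : T), ρ j = Sum.inl x.1 → g j = f x := by
    intro j x hx
    have h : ∃ x : T, ρ j = Sum.inl x.1 := ⟨x, hx⟩
    simp only [g, dif_pos h]
    congr 1
    exact Subtype.ext (Sum.inl_injective (h.choose_spec.symm.trans hx))
  have hg₀ : g i₀ = i := by
    refine dif_neg ?_
    rintro ⟨x, hx⟩
    rw [hρ.apply_self] at hx
    cases hx
  let D : Finset (Fin n) := univ.filter fun j => j = i₀ ∨ ∃ x : T, ρ j = Sum.inl x.1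
  have hD : Set.InjOn g D := by
    intro j hj k hk hjk
    rcases (mem_filter.1 hj).2 with hj₀ | ⟨x, hx⟩ <;>
      rcases (mem_filter.1 hk).2 with hk₀ | ⟨y, hy⟩
    · rw [hj₀, hk₀]
    · rw [hj₀, hg₀, hg k y hy] at hjk
      exact (hfi y hjk.symm).elim
    · rw [hk₀, hg₀, hg j x hx] at hjk
      exact (hfi x hjk).elim
    · rw [hg j x hx, hg k y hy] at hjk
      have := hf hjk
      subst this
      exact hρ.injective (hx.trans hy.symm)
  obtain ⟨σ, hσ⟩ := exists_equiv_extend_of_card_eq (t := (univ : Finset (Fin n))) (by simp)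
    (subset_univ _) hD
  let e : (univ : Finset (Fin n)) ≃ Fin n := Equiv.subtypeUnivEquiv mem_univ
  refine ⟨σ.trans e, ?_, ?_⟩
  · exact (hσ i₀ (mem_filter.2 ⟨mem_univ _, Or.inl rfl⟩)).trans hg₀
  · intro j x hx
    have hxi : inc (b i) x.1 := by
      rcases hρ.cases j with h | ⟨y, hy, h⟩
      · rw [h] at hx
        cases hx
      · rw [h] at hx
        rw [← Sum.inl_injective hx]
        exact hy
    have h1 : (σ.trans e) j = f ⟨x, hxi⟩ :=
      (hσ j (mem_filter.2 ⟨mem_univ _, Or.inr ⟨⟨x, hxi⟩, hx⟩⟩)).trans (hg j ⟨x, hxi⟩ hx)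
    rw [h1]
    exact hft' ⟨x, hxi⟩

/-- The points determined by the values `Y` of the forms: the point of `q` is killed by all forms
of the arrangement `ρ q` except the one at `i₀`. -/
def genericPoint {R : Type*} [CommRing R] (i₀ : Fin n) (ρ : E → Fin n → FormIndex E n c)
    (Y : FormIndex E n c × Fin n → R) (q : E) : Fin n → R :=
  fun k => (Matrix.of fun j m => Y (ρ q j, m)).adjugate k i₀

/-- For each independent `b`, there are values of the forms for which the points at `b` are linearly
independent. -/
theorem exists_det_genericPoint_ne_zero {K : Type*} [Field K] [Infinite K] {inc : E → Λ → Prop}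
    {i₀ : Fin n} {ρ : E → Fin n → FormIndex E n c}
    (hρ : ∀ q, IsArrangement i₀ {l | inc q l} q (ρ q)) {b : Fin n → E} (hb : Function.Injective b)
    (hall : ∀ i, ∀ L : Finset Λ, (∀ l ∈ L, inc (b i) l) →
      Set.ncard {m | ∀ l ∈ L, inc (b m) l} + ∑ l ∈ L, c l ≤ n) :
    ∃ Y : FormIndex E n c × Fin n → K,
      (Matrix.of fun i => genericPoint i₀ ρ Y (b i)).det ≠ 0 := by
  classical
  -- Each form other than the auxiliary ones at `i₀` loses the coefficients at coordinates whose
  -- points it must kill, so column `i` of the matrix of `b i` survives only in row `i₀`.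
  let mask : FormIndex E n c → Fin n → K := fun r m => match r with
    | Sum.inl x => if inc (b m) x.1 then 0 else 1
    | Sum.inr (p, j) => if p = b m ∧ j ≠ i₀ then 0 else 1
  let F : Fin n → MvPolynomial (FormIndex E n c × Fin n) K := fun i =>
    (Matrix.of fun j m => MvPolynomial.X (ρ (b i) j, m) * MvPolynomial.C (mask (ρ (b i) j) m)).det
  have hF : ∀ i Y, MvPolynomial.eval Y (F i) =
      (Matrix.of fun j m => Y (ρ (b i) j, m) * mask (ρ (b i) j) m).det := by
    intro i Y
    simp only [F]
    rw [RingHom.map_det]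
    congr 1
    ext j m
    simp
  obtain ⟨Y, hY⟩ := exists_forall_eval_ne_zero F fun i => by
    obtain ⟨σ, hσi, hσ⟩ := (hρ (b i)).exists_perm (hall i)
    -- These values turn the masked matrix into the permutation matrix of `σ`. The permutation
    -- depends on `i`, so a generic `Y` is needed to serve all `i` at once.
    refine ⟨fun z => if ∃ j, ρ (b i) j = z.1 ∧ σ j = z.2 then 1 else 0, ?_⟩
    have hmat : (Matrix.of fun j m => (if ∃ k, ρ (b i) k = ρ (b i) j ∧ σ k = m then (1 : K) else 0) *
        mask (ρ (b i) j) m) = (1 : Matrix (Fin n) (Fin n) K).submatrix σ id := by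
      ext j m
      have h1 : (∃ k, ρ (b i) k = ρ (b i) j ∧ σ k = m) ↔ σ j = m := by
        constructor
        · rintro ⟨k, hk, rfl⟩
          rw [(hρ (b i)).injective hk]
        · exact fun h => ⟨j, rfl, h⟩
      simp only [Matrix.of_apply, h1, Matrix.submatrix_apply, id, Matrix.one_apply]
      split_ifs with hm
      · subst hm
        rcases (hρ (b i)).cases j with h | ⟨x, -, h⟩
        · rw [h]
          have : ¬ (b i = b (σ j) ∧ j ≠ i₀) := by
            rintro ⟨h2, h3⟩
            refine h3 (σ.injective ?_)
            rw [hσi, hb h2]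
          simp [mask, this]
        · have := hσ j x h
          rw [h]
          simp [mask, this]
      · simp
    rw [hF, hmat, Matrix.det_permute, Matrix.det_one, mul_one]
    rcases Int.units_eq_one_or (Equiv.Perm.sign σ) with h | h <;> simp [h]
  refine ⟨fun z => Y z * mask z.1 z.2, ?_⟩
  have hcol : ∀ i, (genericPoint i₀ ρ (fun z => Y z * mask z.1 z.2) (b i)) i ≠ 0 ∧
      ∀ k, k ≠ i → (genericPoint i₀ ρ (fun z => Y z * mask z.1 z.2) (b i)) k = 0 := by
    intro i
    refine adjugate_of_col_eq_zero _ ?_ ?_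
    · have := hY i
      rwa [hF] at this
    · intro j hj
      have : mask (ρ (b i) j) i = 0 := by
        rcases (hρ (b i)).cases j with h | ⟨x, hx, h⟩
        · rw [h]
          simp [mask, hj]
        · rw [h]
          have : inc (b i) x.1 := hx
          simp [mask, this]
      simp [this]
  have hdiag : (Matrix.of fun i => genericPoint i₀ ρ (fun z => Y z * mask z.1 z.2) (b i)) =
      Matrix.diagonal fun i => genericPoint i₀ ρ (fun z => Y z * mask z.1 z.2) (b i) i := by
    ext i k
    by_cases hik : i = k
    · subst hik
      simp
    · rw [Matrix.diagonal_apply_ne _ hik]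
      exact (hcol i).2 k (Ne.symm hik)
  rw [hdiag, Matrix.det_diagonal]
  exact prod_ne_zero_iff.2 fun i _ => (hcol i).1

/-- Generic subspaces `W l` of codimension `c l`, together with generic points in the intersections
of the subspaces through them. -/
theorem exists_generic_arrangement {K : Type*} [Field K] [Infinite K] [Fintype Λ] [Finite E]
    (inc : E → Λ → Prop) [∀ q, DecidablePred (inc q)] (hc : ∀ q, ∑ l with inc q l, c l < n) :
    ∃ (W : Λ → Submodule K (Fin n → K)) (γ : E → Fin n → K),
      (∀ q l, inc q l → γ q ∈ W l) ∧
      (∀ b : Fin n → E, Function.Injective b →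
        (∀ i, ∀ L : Finset Λ, (∀ l ∈ L, inc (b i) l) →
          Set.ncard {m | ∀ l ∈ L, inc (b m) l} + ∑ l ∈ L, c l ≤ n) →
        LinearIndependent K fun i => γ (b i)) ∧
      ∀ q, γ q ≠ 0 →
        Module.finrank K (⨅ l ∈ {l | inc q l}, W l : Submodule K (Fin n → K)) +
          ∑ l with inc q l, c l = n ∧
        ∀ l, inc q l → Module.finrank K (W l) + c l = n := by
  classical
  -- A point is needed for `n > 0`, hence for the row `i₀` to exist.
  rcases isEmpty_or_nonempty E with hE | ⟨⟨q₀⟩⟩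
  · refine ⟨fun _ => ⊤, fun q => hE.elim q, fun q => hE.elim q, fun b _ _ => ?_,
      fun q => hE.elim q⟩
    have : IsEmpty (Fin n) := ⟨fun i => hE.elim (b i)⟩
    exact linearIndependent_empty_type
  let i₀ : Fin n := ⟨0, (Nat.zero_le _).trans_lt (hc q₀)⟩
  choose ρ hρ using fun q : E => exists_isArrangement (E := E) i₀ (univ.filter (inc q)) q (hc q)
  simp only [coe_filter, mem_univ, true_and] at hρ
  let ι := {b : Fin n → E // Function.Injective b ∧ ∀ i, ∀ L : Finset Λ,
    (∀ l ∈ L, inc (b i) l) → Set.ncard {m | ∀ l ∈ L, inc (b m) l} + ∑ l ∈ L, c l ≤ n}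
  let G : ι → MvPolynomial (FormIndex E n c × Fin n) K := fun b =>
    (Matrix.of fun i => genericPoint i₀ ρ MvPolynomial.X (b.1 i)).det
  have hG : ∀ b Y, MvPolynomial.eval Y (G b) =
      (Matrix.of fun i => genericPoint i₀ ρ Y (b.1 i)).det := by
    intro b Y
    simp only [G]
    rw [RingHom.map_det]
    congr 1
    ext i k
    have h := congrFun (congrFun (RingHom.map_adjugate (MvPolynomial.eval Y)
      (Matrix.of fun j m => MvPolynomial.X (R := K) (ρ (b.1 i) j, m))) k) i₀
    simp only [RingHom.mapMatrix_apply, Matrix.map_apply] at h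
    simp only [RingHom.mapMatrix_apply, Matrix.map_apply, Matrix.of_apply, genericPoint]
    rw [h]
    congr 2
    ext j m
    simp
  obtain ⟨Y, hY⟩ := exists_forall_eval_ne_zero G fun b => by
    obtain ⟨Y, hY⟩ := exists_det_genericPoint_ne_zero (K := K) hρ b.2.1 b.2.2
    exact ⟨Y, by rwa [hG]⟩
  let A : ∀ l, Matrix (Fin (c l)) (Fin n) K := fun l => Matrix.of fun k m => Y (Sum.inl ⟨l, k⟩, m)
  have hker : ∀ q l, inc q l → genericPoint i₀ ρ Y q ∈ LinearMap.ker (A l).mulVecLin := by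
    intro q l hl
    rw [LinearMap.mem_ker, Matrix.mulVecLin_apply]
    ext k
    obtain ⟨j, hj⟩ := (hρ q).exists_eq ⟨l, k⟩ hl
    have hj₀ : j ≠ i₀ := by
      rintro rfl
      rw [(hρ q).apply_self] at hj
      cases hj
    have h := row_dotProduct_adjugate_eq_zero (Matrix.of fun j m => Y (ρ q j, m)) hj₀
    have hA : A l k = (Matrix.of fun j m => Y (ρ q j, m)) j := by
      ext m
      simp [A, hj]
    rw [Matrix.mulVec, hA]
    exact h
  refine ⟨fun l => LinearMap.ker (A l).mulVecLin, genericPoint i₀ ρ Y, hker, ?_, ?_⟩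
  · intro b hb hall
    have h := hY ⟨b, hb, hall⟩
    rw [hG] at h
    exact Matrix.linearIndependent_rows_of_det_ne_zero h
  · intro q hq
    obtain ⟨i, hi⟩ := Function.ne_iff.1 hq
    let T := {x : Σ l, Fin (c l) // inc q x.1}
    choose f hf using fun x : T => (hρ q).exists_eq x.1 x.2
    -- A nonzero minor shows that the forms through `q` are independent, which gives both dimension
    -- formulas.
    have hli : LinearIndependent K fun x : T => fun m => Y (Sum.inl x.1, m) := by
      have h := linearIndependent_of_adjugate_ne_zero (Matrix.of fun j m => Y (ρ q j, m)) hi f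
        (fun x y hxy => Subtype.ext (Sum.inl_injective (by rw [← hf, ← hf, hxy])))
        (fun x hx => by
          have := hf x
          rw [hx, (hρ q).apply_self] at this
          cases this)
      have heq : (fun x : T => fun m => Y (Sum.inl x.1, m)) =
          fun x => (Matrix.of fun j m => Y (ρ q j, m)) (f x) := by
        ext x m
        simp [hf]
      rw [heq]
      exact h
    constructor
    · have h := finrank_ker_mulVecLin_add_card (A := Matrix.of fun (x : T) m => Y (Sum.inl x.1, m))
        hli
      have hcard : Fintype.card T = ∑ l with inc q l, c l := by
        rw [Fintype.card_subtype]
        have : (univ.filter fun x : Σ l, Fin (c l) => inc q x.1) =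
            (univ.filter (inc q)).sigma fun l => (univ : Finset (Fin (c l))) := by
          ext x
          simp
        rw [this]
        simp
      have hinf : (⨅ l ∈ {l | inc q l}, LinearMap.ker (A l).mulVecLin) =
          LinearMap.ker (Matrix.mulVecLin (Matrix.of fun (x : T) m => Y (Sum.inl x.1, m))) := by
        ext v
        simp only [Submodule.mem_iInf, LinearMap.mem_ker, Matrix.mulVecLin_apply, funext_iff,
          Set.mem_ofPred_eq]
        exact ⟨fun h x => h x.1.1 x.2 x.1.2, fun h l hl k => h ⟨⟨l, k⟩, hl⟩⟩
      rw [hinf, ← hcard]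
      exact h
    · intro l hl
      have h := finrank_ker_mulVecLin_add_card (A := A l)
        (hli.comp (fun k : Fin (c l) => (⟨⟨l, k⟩, hl⟩ : T)) fun k k' h =>
          eq_of_heq (Sigma.mk.inj (congrArg Subtype.val h)).2)
      rwa [Fintype.card_fin] at h

end Generic

/-! ### Ranks and expected dimensions -/

section Rank

variable {α : Type*} {M : Matroid α}

theorem coe_rk (M : Matroid α) [M.RankFinite] (X : Set α) : (rk M X : ℕ∞) = M.eRk X :=
  ENat.natCast_toNat (Matroid.eRk_ne_top_iff.2 (M.isRkFinite_set X))

theorem coe_rank (M : Matroid α) [M.RankFinite] : (rank M : ℕ∞) = M.eRank :=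
  ENat.natCast_toNat (M.eRank_ne_top_iff.2 inferInstance)

theorem finite_subspaces (M : Matroid α) [M.Finite] : (subspaces M).Finite := by
  refine (M.ground_finite.finite_subsets.image (circuitClass M)).subset ?_
  rintro l ⟨C, hC, rfl⟩
  exact ⟨C, hC.1.subset_ground, rfl⟩

instance [M.Finite] : Finite (subspaces M) := finite_subspaces M

theorem mem_circuitClass_self {C : Set α} (hC : IsSmallCircuit M C) : C ∈ circuitClass M C :=
  ⟨hC, rfl⟩

theorem subspaceRank_circuitClass {C : Set α} (hC : IsSmallCircuit M C) :
    subspaceRank M (circuitClass M C) = rk M C :=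
  subspaceRank_eq M ⟨C, hC, rfl⟩ (mem_circuitClass_self hC)

theorem subspaceRank_lt_rank [M.RankFinite] {l : Set (Set α)} (hl : l ∈ subspaces M) :
    subspaceRank M l < rank M := by
  obtain ⟨C, hC, rfl⟩ := hl
  have h := hC.2
  rw [subspaceRank_circuitClass hC]
  rw [← hC.1.eRk_add_one_eq, ← coe_rk, ← coe_rank] at h
  have : rk M C + 1 < rank M + 1 := by exact_mod_cast h
  omega

/-- The codimension of a subspace. -/
noncomputable def codim (M : Matroid α) (l : subspaces M) : ℕ := rank M - subspaceRank M l.1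

theorem expectedDim_image [M.RankFinite] (L : Finset (subspaces M)) :
    expectedDim M (Subtype.val '' (L : Set (subspaces M))) =
      rank M - ((∑ l ∈ L, codim M l : ℕ) : ℤ) := by
  rw [expectedDim, finsum_mem_image Subtype.val_injective.injOn, finsum_mem_coe_finset,
    Set.ncard_image_of_injective _ Subtype.val_injective, Set.ncard_coe_finset]
  have h : ((∑ l ∈ L, codim M l : ℕ) : ℤ) = ∑ l ∈ L, ((rank M : ℤ) - subspaceRank M l.1) := by
    push_cast
    refine sum_congr rfl fun l _ => ?_
    rw [codim, Nat.cast_sub (subspaceRank_lt_rank l.2).le]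
  rw [h, sum_sub_distrib, sum_const, nsmul_eq_mul]
  ring

open Classical in
theorem expectedDim_eq [M.RankFinite] [Fintype (subspaces M)] {L : Set (Set (Set α))}
    (hL : L ⊆ subspaces M) :
    expectedDim M L = rank M - ((∑ l : subspaces M with l.1 ∈ L, codim M l : ℕ) : ℤ) := by
  rw [← expectedDim_image]
  congr 1
  ext l
  simpa using fun h => hL h

open Classical in
theorem expectedDim_subspacesThrough [M.RankFinite] [Fintype (subspaces M)] (q : α) :
    expectedDim M (subspacesThrough M q) =
      rank M - ((∑ l : subspaces M with q ∈ pointsOf l.1, codim M l : ℕ) : ℤ) := by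
  rw [expectedDim_eq fun l hl => hl.1]
  simp only [subspacesThrough, Set.mem_ofPred_eq, Subtype.coe_prop, true_and]

end Rank

/-! ### The case `P_M = ∅` -/

section NonposEmpty

variable {α : Type*} {M : Matroid α}

/-- After this, only the stage `j = 0` of the special and stable conditions has content. -/
theorem ground_solvableChain_succ (hP : nonposPoints M = ∅) (j : ℕ) :
    (solvableChain M (j + 1)).E = ∅ := by
  induction j with
  | zero => exact hP
  | succ j ih =>
    refine Set.eq_empty_of_subset_empty fun p hp => ?_
    rw [← ih]
    exact hp.1

theorem isSpecial_iff (hP : nonposPoints M = ∅) :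
    IsSpecial M ↔ ∀ q ∈ M.E, ∀ L ⊆ subspacesThrough M q,
      (rk M {p | p ∈ M.E ∧ ∀ l ∈ L, p ∈ pointsOf l} : ℤ) ≤ expectedDim M L := by
  constructor
  · intro h q hq L hL
    refine h.2 0 q ⟨hq, fun h' => ?_⟩ L hL
    rw [ground_solvableChain_succ hP 0] at h'
    exact h'
  · refine fun h => ⟨⟨1, ground_solvableChain_succ hP 0⟩, fun j q hq L hL => ?_⟩
    cases j with
    | zero => exact h q hq.1 L hL
    | succ j =>
      have := hq.1
      rw [ground_solvableChain_succ hP j] at this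
      exact this.elim

theorem mem_stableRealizations_iff (hP : nonposPoints M = ∅) {γ : M.E → (Fin (rank M) → ℂ)} :
    γ ∈ stableRealizations M ↔ γ ∈ realizationSpace M (rank M) ∧
      ∀ p ∈ M.E, (Module.finrank ℂ (meetAt M γ p) : ℤ) = expectedDim M (subspacesThrough M p) := by
  have hnot : ∀ p, p ∉ nonposPoints M := fun p hp => by simp [hP] at hp
  constructor
  · exact fun h => ⟨h.1, fun p hp => (h.2 0).2 p hp (hnot p)⟩
  · refine fun h => ⟨h.1, fun j => ?_⟩
    cases j with
    | zero => exact ⟨fun C hC hC' => hC.not_indep ((h.1 C).2 hC'), fun p hp _ => h.2 p hp⟩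
    | succ j =>
      have hE := ground_solvableChain_succ hP j
      refine ⟨fun C hC => ?_, fun p hp => ?_⟩
      · obtain ⟨p, hp⟩ := hC.nonempty
        have := hC.subset_ground hp
        rw [hE] at this
        exact this.elim
      · rw [hE] at hp
        exact hp.elim

theorem sum_codim_lt_rank [M.RankFinite] [Fintype (subspaces M)] (hP : nonposPoints M = ∅)
    [∀ q, DecidablePred fun l : subspaces M => q ∈ pointsOf l.1] {q : α} (hq : q ∈ M.E) :
    ∑ l : subspaces M with q ∈ pointsOf l.1, codim M l < rank M := by
  have h : ¬ expectedDim M (subspacesThrough M q) ≤ 0 := fun h => by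
    have : q ∈ nonposPoints M := ⟨hq, h⟩
    simp [hP] at this
  rw [expectedDim_subspacesThrough, sub_nonpos, not_le, Nat.cast_lt] at h
  convert h

/-- A loop would itself form a small circuit of rank `0`, hence a subspace of codimension `n`,
forcing `a_q ≤ 0`. -/
theorem isNonloop_of_nonposPoints_eq_empty [M.Finite] (hP : nonposPoints M = ∅) {q : α}
    (hq : q ∈ M.E) : M.IsNonloop q := by
  classical
  have := Fintype.ofFinite (subspaces M)
  have hsum := sum_codim_lt_rank hP hq
  refine (M.not_isLoop_iff hq).1 fun hloop => ?_
  have hC : M.IsCircuit {q} := Matroid.singleton_isCircuit.2 hloop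
  have hrk : rk M {q} = 0 := by simp [rk, hloop.eRk_eq]
  have hsmall : IsSmallCircuit M {q} := by
    refine ⟨hC, ?_⟩
    rw [Set.encard_singleton, ← coe_rank]
    exact_mod_cast (by omega : 1 < rank M + 1)
  let l : subspaces M := ⟨circuitClass M {q}, {q}, hsmall, rfl⟩
  have hql : q ∈ pointsOf l.1 := ⟨{q}, mem_circuitClass_self hsmall, rfl⟩
  have h1 : codim M l ≤ ∑ l : subspaces M with q ∈ pointsOf l.1, codim M l :=
    single_le_sum (f := codim M) (fun _ _ => Nat.zero_le _) (mem_filter.2 ⟨mem_univ l, hql⟩)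
  have h2 : codim M l = rank M := by
    rw [codim, subspaceRank_circuitClass hsmall, hrk, Nat.sub_zero]
  omega

end NonposEmpty

/-! ### Realizations -/

section Realization

variable {α : Type*} {M : Matroid α}

/-- If independent sets are realized by independent vectors, then ranks do not drop. -/
theorem rk_le_finrank_span [M.RankFinite] {d : ℕ} {γ : M.E → (Fin d → ℂ)}
    (hγ : ∀ I : Set M.E, M.Indep (Subtype.val '' I) → LinearIndepOn ℂ γ I) (X : Set α) :
    rk M X ≤ Module.finrank ℂ (Submodule.span ℂ (γ '' {p | (p : α) ∈ X})) := by
  obtain ⟨I, hI⟩ := M.exists_isBasis' X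
  have hIE : Subtype.val '' (Subtype.val ⁻¹' I : Set M.E) = I :=
    Subtype.image_preimage_coe M.E I ▸ Set.inter_eq_right.2 hI.indep.subset_ground
  have hli := hγ (Subtype.val ⁻¹' I) (by rw [hIE]; exact hI.indep)
  have hcard : (rk M X : ℕ∞) = (Subtype.val ⁻¹' I : Set M.E).encard := by
    rw [coe_rk, ← hI.encard_eq_eRk, ← Subtype.val_injective.encard_image, hIE]
  have hfin : (Subtype.val ⁻¹' I : Set M.E).Finite :=
    Set.finite_of_encard_eq_coe hcard.symm
  have := hfin.fintype
  have h1 : rk M X = Fintype.card (Subtype.val ⁻¹' I : Set M.E) := by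
    rw [Set.encard_eq_coe_toFinset_card, Set.toFinset_card] at hcard
    exact_mod_cast hcard
  rw [h1, ← finrank_span_eq_card hli]
  refine Submodule.finrank_mono (Submodule.span_mono ?_)
  rintro _ ⟨p, rfl⟩
  exact ⟨p, hI.subset p.2, rfl⟩

theorem span_range_eq_top [M.RankFinite] {γ : M.E → (Fin (rank M) → ℂ)}
    (hγ : ∀ I : Set M.E, M.Indep (Subtype.val '' I) → LinearIndepOn ℂ γ I) :
    Submodule.span ℂ (Set.range γ) = ⊤ := by
  refine Submodule.eq_top_of_finrank_eq (le_antisymm (Submodule.finrank_le _) ?_)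
  have h := rk_le_finrank_span hγ M.E
  have h1 : rk M M.E = rank M := by rw [rk, rank, M.eRk_ground]
  have h2 : γ '' {p | (p : α) ∈ M.E} = Set.range γ := by
    rw [← Set.image_univ]
    congr 1
    ext p
    simp
  rw [h1, h2] at h
  rwa [Module.finrank_fin_fun]

/-! ### Stable implies special -/

/-- Intersecting with subspaces lowers the dimension by at most the sum of the codimensions. -/
theorem finrank_le_finrank_inf_iInf_add {K ι : Type*} [Field K] {n : ℕ}
    (V : Submodule K (Fin n → K)) (U : ι → Submodule K (Fin n → K)) (c : ι → ℕ)
    (T : Finset ι) (hU : ∀ l ∈ T, n ≤ Module.finrank K (U l) + c l) :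
    Module.finrank K V ≤
      Module.finrank K (V ⊓ ⨅ l ∈ T, U l : Submodule K (Fin n → K)) + ∑ l ∈ T, c l := by
  classical
  induction T using Finset.induction_on with
  | empty =>
    have h : (V ⊓ ⨅ l ∈ (∅ : Finset ι), U l) = V := by simp
    rw [h, sum_empty, add_zero]
  | insert a T ha ih =>
    have h1 := ih fun l hl => hU l (mem_insert_of_mem hl)
    have h2 := Submodule.finrank_sup_add_finrank_inf_eq (V ⊓ ⨅ l ∈ T, U l) (U a)
    have h3 := Submodule.finrank_le ((V ⊓ ⨅ l ∈ T, U l) ⊔ U a)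
    have h4 := hU a (mem_insert_self a T)
    rw [Module.finrank_fin_fun] at h3
    have h5 : (V ⊓ ⨅ l ∈ insert a T, U l) = (V ⊓ ⨅ l ∈ T, U l) ⊓ U a := by
      rw [Finset.iInf_insert, inf_comm (U a), inf_assoc]
    rw [h5, sum_insert ha]
    omega

theorem isSpecial_of_mem_stableRealizations [M.Finite] (hP : nonposPoints M = ∅)
    {γ : M.E → (Fin (rank M) → ℂ)} (hγ : γ ∈ stableRealizations M) : IsSpecial M := by
  classical
  have := Fintype.ofFinite (subspaces M)
  obtain ⟨hr, hd⟩ := (mem_stableRealizations_iff hP).1 hγ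
  have hli := fun I => (hr I).1
  rw [isSpecial_iff hP]
  intro q hq L hL
  have hLs : L ⊆ subspaces M := fun l hl => (hL hl).1
  let V : Submodule ℂ (Fin (rank M) → ℂ) := ⨅ l ∈ L, subspaceSpan γ l
  let S : Finset (subspaces M) := univ.filter fun l => l.1 ∈ L
  let Q : Finset (subspaces M) := univ.filter fun l => q ∈ pointsOf l.1
  have hSQ : S ⊆ Q := fun l hl => mem_filter.2 ⟨mem_univ _, (hL (mem_filter.1 hl).2).2⟩
  have h1 := rk_le_finrank_span hli {p | p ∈ M.E ∧ ∀ l ∈ L, p ∈ pointsOf l}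
  have h2 : Submodule.span ℂ (γ '' {p | (p : α) ∈ {p | p ∈ M.E ∧ ∀ l ∈ L, p ∈ pointsOf l}}) ≤ V :=
    le_iInf₂ fun l hl => Submodule.span_mono (Set.image_mono fun p hp => hp.2 l hl)
  -- Only the subspaces through `q` outside `L` are cut in; their codimensions are the difference
  -- between `a_L` and `a_q`.
  have h3 := finrank_le_finrank_inf_iInf_add V (fun l : subspaces M => subspaceSpan γ l.1)
    (codim M) (Q \ S) fun l _ => by
      have := rk_le_finrank_span hli (pointsOf l.1)
      change rank M ≤ Module.finrank ℂ (Submodule.span ℂ (γ '' {p | (p : α) ∈ pointsOf l.1})) +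
        (rank M - rk M (pointsOf l.1))
      omega
  have h4 : V ⊓ ⨅ l ∈ Q \ S, subspaceSpan γ l.1 ≤ meetAt M γ q := by
    rw [meetAt, span_range_eq_top hli, top_inf_eq]
    refine le_iInf₂ fun l hl => ?_
    by_cases hlL : l ∈ L
    · exact inf_le_left.trans (iInf₂_le l hlL)
    · have hm : (⟨l, hl.1⟩ : subspaces M) ∈ Q \ S := by simp [Q, S, hlL, hl.2]
      exact inf_le_right.trans (iInf₂_le (⟨l, hl.1⟩ : subspaces M) hm)
  have h5 := hd q hq
  rw [expectedDim_subspacesThrough] at h5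
  rw [expectedDim_eq hLs]
  have h6 := Submodule.finrank_mono h2
  have h7 := Submodule.finrank_mono h4
  have h8 : ∑ l ∈ Q \ S, codim M l + ∑ l ∈ S, codim M l = ∑ l ∈ Q, codim M l := sum_sdiff hSQ
  change _ ≤ (rank M : ℤ) - ((∑ l ∈ S, codim M l : ℕ) : ℤ)
  change _ = (rank M : ℤ) - ((∑ l ∈ Q, codim M l : ℕ) : ℤ) at h5
  omega

/-! ### Special implies stable -/

/-- Circuits are dependent in a collection of vectors whose members on each subspace `l` lie in a
space of dimension `rank l`. -/
theorem not_linearIndepOn_of_isCircuit [M.RankFinite] {γ : M.E → (Fin (rank M) → ℂ)}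
    (W : subspaces M → Submodule ℂ (Fin (rank M) → ℂ))
    (hW : ∀ (p : M.E) (l : subspaces M), (p : α) ∈ pointsOf l.1 →
      γ p ∈ W l ∧ Module.finrank ℂ (W l) + codim M l = rank M)
    {C : Set M.E} (hC : M.IsCircuit (Subtype.val '' C)) : ¬ LinearIndepOn ℂ γ C := by
  intro hli
  have hcard : C.encard = (rk M (Subtype.val '' C) + 1 : ℕ) := by
    rw [← Subtype.val_injective.encard_image, ← hC.eRk_add_one_eq, ← coe_rk]
    rfl
  have hfin : C.Finite := Set.finite_of_encard_eq_coe hcard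
  have := hfin.fintype
  have hcard' : Fintype.card C = rk M (Subtype.val '' C) + 1 := by
    rw [Set.encard_eq_coe_toFinset_card, Set.toFinset_card] at hcard
    exact_mod_cast hcard
  have hspan := finrank_span_eq_card hli
  -- A small circuit has one element more than `dim W l`; any other has more than `n` elements.
  by_cases hs : (Subtype.val '' C).encard < M.eRank + 1
  · have hsmall : IsSmallCircuit M (Subtype.val '' C) := ⟨hC, hs⟩
    let l : subspaces M := ⟨circuitClass M (Subtype.val '' C), _, hsmall, rfl⟩
    have hmem : ∀ p ∈ C, (p : α) ∈ pointsOf l.1 := fun p hp =>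
      ⟨_, mem_circuitClass_self hsmall, p, hp, rfl⟩
    obtain ⟨_, p, hp, rfl⟩ := hC.nonempty
    have hle : Submodule.span ℂ (Set.range fun p : C => γ p) ≤ W l := by
      rw [Submodule.span_le]
      rintro _ ⟨p, rfl⟩
      exact (hW p l (hmem p p.2)).1
    have h1 := Submodule.finrank_mono hle
    have h2 := (hW p l (hmem p hp)).2
    have h3 := subspaceRank_lt_rank l.2
    have h4 : subspaceRank M l.1 = rk M (Subtype.val '' C) := subspaceRank_circuitClass hsmall
    have h5 : codim M l = rank M - subspaceRank M l.1 := rfl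
    omega
  · rw [Subtype.val_injective.encard_image, hcard, ← coe_rank] at hs
    have h1 : ¬ rk M (Subtype.val '' C) + 1 < rank M + 1 := fun h => hs (by exact_mod_cast h)
    have h2 := Submodule.finrank_le (Submodule.span ℂ (Set.range fun p : C => γ p))
    rw [Module.finrank_fin_fun] at h2
    omega

theorem nonempty_stableRealizations [M.Finite] (hP : nonposPoints M = ∅) (hM : IsSpecial M) :
    (stableRealizations M).Nonempty := by
  classical
  have := Fintype.ofFinite (subspaces M)
  have : Finite M.E := M.ground_finite
  rw [isSpecial_iff hP] at hM
  obtain ⟨W, γ, hmem, hbase, hdim⟩ := exists_generic_arrangement (K := ℂ) (c := codim M)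
    (fun (q : M.E) (l : subspaces M) => (q : α) ∈ pointsOf l.1) fun q => sum_codim_lt_rank hP q.2
  have hli : ∀ I : Set M.E, M.Indep (Subtype.val '' I) → LinearIndepOn ℂ γ I := by
    intro I hI
    obtain ⟨B, hB, hIB⟩ := hI.exists_isBase_superset
    have hBE : Subtype.val '' (Subtype.val ⁻¹' B : Set M.E) = B :=
      Subtype.image_preimage_coe M.E B ▸ Set.inter_eq_right.2 hB.subset_ground
    have hcard : Nat.card (Subtype.val ⁻¹' B : Set M.E) = rank M := by
      rw [Nat.card_coe_set_eq, Set.ncard, ← Subtype.val_injective.encard_image, hBE,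
        hB.encard_eq_eRank, rank]
    let e : Fin (rank M) ≃ (Subtype.val ⁻¹' B : Set M.E) := (Finite.equivFinOfCardEq hcard).symm
    have hb : Function.Injective fun i => (e i : M.E) := Subtype.val_injective.comp e.injective
    -- The basis points common to `L` are independent, so their number is at most the rank bounded
    -- by `a_L`.
    have h := hbase (fun i => (e i : M.E)) hb fun i L hL => by
      have h1 := hM (e i : M.E) (e i : M.E).2 (Subtype.val '' (L : Set (subspaces M))) <| by
        rintro _ ⟨l, hl, rfl⟩
        exact ⟨l.2, hL l hl⟩
      rw [expectedDim_image] at h1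
      let Z : Set (Fin (rank M)) := {m | ∀ l ∈ L, ((e m : M.E) : α) ∈ pointsOf l.1}
      have h2 : (Z.ncard : ℕ∞) ≤ rk M {p | p ∈ M.E ∧
          ∀ l ∈ (Subtype.val '' (L : Set (subspaces M))), p ∈ pointsOf l} := by
        rw [Z.toFinite.cast_ncard_eq, coe_rk,
          ← (Subtype.val_injective.comp hb).encard_image Z]
        refine (hB.indep.subset ?_).encard_le_eRk_of_subset ?_
        · rintro _ ⟨m, -, rfl⟩
          exact (e m).2
        · rintro _ ⟨m, hm, rfl⟩
          refine ⟨(e m : M.E).2, ?_⟩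
          rintro _ ⟨l, hl, rfl⟩
          exact hm l hl
      have h3 := Nat.cast_le.1 h2
      change Z.ncard + _ ≤ _
      omega
    have h' : LinearIndepOn ℂ γ (Subtype.val ⁻¹' B) :=
      (linearIndependent_equiv e (f := fun p : (Subtype.val ⁻¹' B : Set M.E) => γ p)).1 h
    exact h'.mono fun p hp => hIB ⟨p, hp, rfl⟩
  have hne : ∀ q, γ q ≠ 0 := by
    intro q
    have h := hli {q} (by
      rw [Set.image_singleton]
      exact (isNonloop_of_nonposPoints_eq_empty hP q.2).indep)
    exact h.ne_zero rfl
  have hW : ∀ (p : M.E) (l : subspaces M), (p : α) ∈ pointsOf l.1 →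
      γ p ∈ W l ∧ Module.finrank ℂ (W l) + codim M l = rank M :=
    fun p l hl => ⟨hmem p l hl, (hdim p (hne p)).2 l hl⟩
  refine ⟨γ, (mem_stableRealizations_iff hP).2 ⟨fun I => ⟨hli I, fun hI => ?_⟩, fun q hq => ?_⟩⟩
  · have hIE : Subtype.val '' I ⊆ M.E := by
      rintro _ ⟨p, -, rfl⟩
      exact p.2
    rw [Matroid.indep_iff_forall_subset_not_isCircuit hIE]
    intro C hCI hC
    obtain ⟨C', hC', rfl⟩ := Set.subset_image_iff.1 hCI
    exact not_linearIndepOn_of_isCircuit W hW hC (hI.mono hC')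
  -- The span lies in `W l`, and its dimension is at least `rank l = dim W l`.
  · have hspan : ∀ l : subspaces M, q ∈ pointsOf l.1 → subspaceSpan γ l.1 = W l := by
      intro l hl
      refine Submodule.eq_of_le_of_finrank_le ?_ ?_
      · rw [subspaceSpan, Submodule.span_le]
        rintro _ ⟨p, hp, rfl⟩
        exact hmem p l hp
      · have h1 := (hW ⟨q, hq⟩ l hl).2
        have h2 : subspaceRank M l.1 ≤ Module.finrank ℂ (subspaceSpan γ l.1) :=
          rk_le_finrank_span hli (pointsOf l.1)
        have h3 := subspaceRank_lt_rank l.2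
        have h5 : codim M l = rank M - subspaceRank M l.1 := rfl
        omega
    have hmeet : meetAt M γ q = ⨅ l ∈ {l : subspaces M | q ∈ pointsOf l.1}, W l := by
      rw [meetAt, span_range_eq_top hli, top_inf_eq]
      refine le_antisymm (le_iInf₂ fun l hl => ?_) (le_iInf₂ fun l hl => ?_)
      · rw [← hspan l hl]
        exact iInf₂_le l.1 ⟨l.2, hl⟩
      · rw [hspan ⟨l, hl.1⟩ hl.2]
        exact iInf₂_le (⟨l, hl.1⟩ : subspaces M) hl.2
    have h := (hdim ⟨q, hq⟩ (hne _)).1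
    rw [hmeet, expectedDim_subspacesThrough]
    exact eq_sub_of_add_eq (by exact_mod_cast h)

end Realization

end StableMatroid

theorem mainTheorem6 {α : Type*} (M : Matroid α) [M.Finite]
    (hP : StableMatroid.nonposPoints M = ∅) :
    (StableMatroid.IsSpecial M →
      (StableMatroid.stableRealizations M).Nonempty ∧ StableMatroid.IsRealizable M) ∧
    (StableMatroid.IsSpecial M ↔ (StableMatroid.stableRealizations M).Nonempty) := by
  refine ⟨fun hM => ?_, StableMatroid.nonempty_stableRealizations hP, fun ⟨γ, hγ⟩ =>
    StableMatroid.isSpecial_of_mem_stableRealizations hP hγ⟩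
  have h := StableMatroid.nonempty_stableRealizations hP hM
  exact ⟨h, h.mono fun γ hγ => hγ.1⟩
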